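/- Let $n\ge 0$ and let $H_1,\dots,H_L$ be Hermitian $2^n\times 2^n$ matrices, defining the parametrized circuit $U(\theta)=\prod_{l=1}^L e^{iH_l\theta_l}$, $\theta\in\mathbb R^L$. Let $\mathfrak g\subseteq\mathfrak u(2^n)$ be its dynamical Lie algebra, i.e. the real Lie algebra generated by $iH_1,\dots,iH_L$, and let $$\mathfrak g=\mathfrak g_1\oplus\dots\oplus\mathfrak g_{k-1}\oplus\mathfrak g_k$$ be a decomposition into a direct sum of ideals with $\mathfrak g_1,\dots,\mathfrak g_{k-1}$ simple and $\mathfrak g_k$ abelian (so that $\mathfrak g_k$ is the center of $\mathfrak g$). Let $G$ be the closed subgroup of the unitary group $\mathrm U(2^n)$ generated by $e^{\mathfrak g}$ (thus $G=e^{\mathfrak g}$ when $e^{\mathfrak g}$ is compact), with normalized Haar measure $\mu$. Let $\theta$ be distributed according to a probability measure on $\mathbb R^L$ such that the circuit is a $2$-design over $G$: $$\mathbb E_\theta\big[U(\theta)^{\otimes 2}A\,(U(\theta)^\dagger)^{\otimes 2}\big]=\int_G V^{\otimes 2}A\,(V^\dagger)^{\otimes 2}\,d\mu(V)\quad\text{for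 every operator } A \text{ on } ((\mathbb C^2)^{\otimes n})^{\otimes 2}.$$ Let $\rho$ be a density matrix and $O$ a Hermitian matrix of size $2^n$, with $O\in i\mathfrak g$ or $\rho\in i\mathfrak g$, and let $\ell_\theta(\rho,O)=\mathrm{Tr}[U(\theta)\rho U(\theta)^\dagger O]$. For a real subspace $\mathfrak h\subseteq\mathfrak u(2^n)$ let $A_{\mathfrak h}$ be the orthogonal projection of $A$ onto $\mathrm{span}_{\mathbb C}\mathfrak h$ for the Hilbert--Schmidt inner product $\langle A,B\rangle=\mathrm{Tr}[A^\dagger B]$, and for Hermitian $A$ let $\mathcal P_{\mathfrak h}(A)=\mathrm{Tr}[A_{\mathfrak h}^2]$ be its $\mathfrak h$-purity. Then $$\mathbb E_\theta[\ell_\theta(\rho,O)]=\mathrm{Tr}[\rho_{\mathfrak g_k}O_{\mathfrak g_k}],\qquad \mathrm{Var}_\theta[\ell_\theta(\rho,O)]=\sum_{j=1}^{k-1}\frac{\mathcal P_{\mathfrak g_j}(\rho)\,\mathcal P_{\mathfrak g_j}(O)}{\dim(\mathfrak g_j)}.$$ -/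

import Mathlib

open MeasureTheory ProbabilityTheory
open scoped Matrix Topology ComplexOrder

attribute [local instance 100] LieRing.ofAssociativeRing

noncomputable section

namespace LieCircuit

variable {d : Type*} [Fintype d] [DecidableEq d]

/-- The parametrized circuit `U(θ) = ∏_l exp(i θ_l H_l)`, in the order `l = 0, 1, …, L - 1`. -/
def circuit {L : ℕ} (H : Fin L → Matrix d d ℂ) (θ : Fin L → ℝ) : Matrix d d ℂ :=
  (List.ofFn fun l => NormedSpace.exp ((Complex.I * (θ l : ℂ)) • H l)).prod

/-- The loss `ℓ_θ(ρ, O) = Tr[U(θ) ρ U(θ)† O]` as a real number; see `coe_loss`. -/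
def loss {L : ℕ} (H : Fin L → Matrix d d ℂ) (ρ O : Matrix d d ℂ) (θ : Fin L → ℝ) : ℝ :=
  (Matrix.trace (circuit H θ * ρ * (circuit H θ)ᴴ * O)).re

/-- For Hermitian `ρ` and `O` the trace defining the loss is real, so no information is lost by
taking the real part in `loss`. -/
theorem coe_loss {L : ℕ} (H : Fin L → Matrix d d ℂ) {ρ O : Matrix d d ℂ}
    (hρ : ρ.IsHermitian) (hO : O.IsHermitian) (θ : Fin L → ℝ) :
    (loss H ρ O θ : ℂ) = Matrix.trace (circuit H θ * ρ * (circuit H θ)ᴴ * O) := by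
  unfold loss
  generalize circuit H θ = U
  apply Complex.conj_eq_iff_re.mp
  rw [starRingEnd_apply, ← Matrix.trace_conjTranspose]
  simp only [Matrix.conjTranspose_mul, Matrix.conjTranspose_conjTranspose, hρ.eq, hO.eq]
  rw [Matrix.trace_mul_comm]
  simp only [Matrix.mul_assoc]

/-- A density matrix (quantum state): positive semidefinite of trace one. -/
def IsDensityMatrix (ρ : Matrix d d ℂ) : Prop :=
  ρ.PosSemidef ∧ ρ.trace = 1

/-- The dynamical Lie algebra: the real Lie algebra of matrices generated by the `i H_l`. -/
def dla {L : ℕ} (H : Fin L → Matrix d d ℂ) : LieSubalgebra ℝ (Matrix d d ℂ) :=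
  LieSubalgebra.lieSpan ℝ (Matrix d d ℂ) (Set.range fun l => Complex.I • H l)

/-- An ideal of a Lie algebra of matrices, as a real subspace of the space of all matrices. -/
def idealSpace {𝔤 : LieSubalgebra ℝ (Matrix d d ℂ)} (𝔞 : LieIdeal ℝ 𝔤) :
    Submodule ℝ (Matrix d d ℂ) :=
  𝔞.toSubmodule.map 𝔤.toSubmodule.subtype

/-- `𝔤 = 𝔤₁ ⊕ … ⊕ 𝔤ₘ ⊕ 𝔷` as a direct sum of ideals, the `𝔤ⱼ` being simple and `𝔷` abelian
(so that `𝔷` is the center of `𝔤`). -/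
structure IsReductiveDecomposition {𝔤 : LieSubalgebra ℝ (Matrix d d ℂ)} {m : ℕ}
    (𝔰 : Fin m → LieIdeal ℝ 𝔤) (𝔷 : LieIdeal ℝ 𝔤) : Prop where
  simple : ∀ j, LieAlgebra.IsSimple ℝ (𝔰 j)
  abelian : IsLieAbelian 𝔷
  isInternal : DirectSum.IsInternal fun j : Option (Fin m) =>
    (j.elim 𝔷 𝔰 : LieIdeal ℝ 𝔤).toSubmodule

/-! ### The group generated by a Lie algebra of matrices and its Haar measure -/

/-- The closed subgroup of the unitary group generated by the exponentials of the elements of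
`𝔤`. For `𝔤 ⊆ 𝔲(d)` it is equal to `e^𝔤` as soon as the latter is compact. -/
def expGroup (𝔤 : LieSubalgebra ℝ (Matrix d d ℂ)) : Subgroup (unitary (Matrix d d ℂ)) :=
  (Subgroup.closure {U : unitary (Matrix d d ℂ) |
    ∃ X ∈ 𝔤, (U : Matrix d d ℂ) = NormedSpace.exp X}).topologicalClosure

instance instCompactSpaceUnitary : CompactSpace (unitary (Matrix d d ℂ)) := by
  apply isCompact_iff_compactSpace.mp
  let _ : NormedAddCommGroup (Matrix d d ℂ) := Matrix.normedAddCommGroup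
  let _ : NormedSpace ℝ (Matrix d d ℂ) := Matrix.normedSpace
  have : ProperSpace (Matrix d d ℂ) := FiniteDimensional.proper ℝ _
  apply Metric.isCompact_of_isClosed_isBounded
  · exact isClosed_unitary (R := Matrix d d ℂ)
  · refine (Metric.isBounded_closedBall (x := (0 : Matrix d d ℂ)) (r := 1)).subset ?_
    intro U hU
    rw [mem_closedBall_zero_iff]
    exact entrywise_sup_norm_bound_of_unitary hU

instance instCompactSpaceExpGroup (𝔤 : LieSubalgebra ℝ (Matrix d d ℂ)) :
    CompactSpace (expGroup 𝔤) :=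
  isCompact_iff_compactSpace.mp (Subgroup.isClosed_topologicalClosure _).isCompact

instance instMeasurableSpaceExpGroup (𝔤 : LieSubalgebra ℝ (Matrix d d ℂ)) :
    MeasurableSpace (expGroup 𝔤) := borel _

instance instBorelSpaceExpGroup (𝔤 : LieSubalgebra ℝ (Matrix d d ℂ)) :
    BorelSpace (expGroup 𝔤) := ⟨rfl⟩

/-- The normalized Haar measure on the compact group `expGroup 𝔤`. -/
def haar (𝔤 : LieSubalgebra ℝ (Matrix d d ℂ)) : Measure (expGroup 𝔤) :=
  Measure.haarMeasure ⊤

/-! ### Designs -/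

/-- The tensor power `A^{⊗ t}`, as a matrix indexed by `t`-tuples. -/
def tensorPow (A : Matrix d d ℂ) (t : ℕ) : Matrix (Fin t → d) (Fin t → d) ℂ :=
  Matrix.of fun a b => ∏ s, A (a s) (b s)

/-- The `t`-th moment operator `A ↦ ∫ U^{⊗ t} A (U†)^{⊗ t} dμ` of a random matrix `U`. -/
def moment {Ω : Type*} [MeasurableSpace Ω] (μ : Measure Ω) (U : Ω → Matrix d d ℂ) (t : ℕ)
    (A : Matrix (Fin t → d) (Fin t → d) ℂ) : Matrix (Fin t → d) (Fin t → d) ℂ :=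
  Matrix.of fun a b => ∫ ω, (tensorPow (U ω) t * A * tensorPow (U ω)ᴴ t) a b ∂μ

/-- The random matrix `U` forms a `t`-design over the group generated by `𝔤`: its `t`-th moment
operator is that of the Haar measure. -/
def IsDesign {Ω : Type*} [MeasurableSpace Ω] (μ : Measure Ω) (U : Ω → Matrix d d ℂ) (t : ℕ)
    (𝔤 : LieSubalgebra ℝ (Matrix d d ℂ)) : Prop :=
  ∀ A, moment μ U t A =
    moment (haar 𝔤) (fun V : expGroup 𝔤 => ((V : unitary (Matrix d d ℂ)) : Matrix d d ℂ)) t A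

/-! ### Projections and purities -/

/-- Matrices as vectors; this turns the Hilbert–Schmidt inner product into the standard one. -/
def vec : Matrix d d ℂ ≃ₗ[ℂ] EuclideanSpace ℂ (d × d) where
  toFun A := WithLp.toLp 2 fun p => A p.1 p.2
  invFun v := Matrix.of fun i j => v (i, j)
  map_add' _ _ := rfl
  map_smul' _ _ := rfl
  left_inv _ := rfl
  right_inv _ := rfl

/-- The orthogonal projection `A_V` of a matrix `A` onto the complex span of a real subspace `V`,
for the Hilbert–Schmidt inner product `Tr[A† B]`. -/
def proj (V : Submodule ℝ (Matrix d d ℂ)) (A : Matrix d d ℂ) : Matrix d d ℂ :=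
  vec.symm (((Submodule.span ℂ (V : Set (Matrix d d ℂ))).map
    vec.toLinearMap).starProjection (vec A))

theorem inner_vec (A B : Matrix d d ℂ) : inner ℂ (vec A) (vec B) = Matrix.trace (Aᴴ * B) := by
  have h (A : Matrix d d ℂ) (p : d × d) : vec A p = A p.1 p.2 := rfl
  simp only [PiLp.inner_apply, h, Matrix.trace, Matrix.diag, Matrix.mul_apply,
    Matrix.conjTranspose_apply, Fintype.sum_prod_type, RCLike.inner_apply, RCLike.star_def]
  rw [Finset.sum_comm]
  simp only [mul_comm]

theorem proj_mem (V : Submodule ℝ (Matrix d d ℂ)) (A : Matrix d d ℂ) :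
    proj V A ∈ Submodule.span ℂ (V : Set (Matrix d d ℂ)) := by
  obtain ⟨C, hC, h⟩ := Submodule.starProjection_apply_mem
    ((Submodule.span ℂ (V : Set (Matrix d d ℂ))).map
      vec.toLinearMap) (vec A)
  have : proj V A = C := by
    unfold proj
    rw [← h]
    exact vec.symm_apply_apply C
  rwa [this]

theorem trace_sub_proj (V : Submodule ℝ (Matrix d d ℂ)) (A : Matrix d d ℂ) {C : Matrix d d ℂ}
    (hC : C ∈ Submodule.span ℂ (V : Set (Matrix d d ℂ))) :
    Matrix.trace (Cᴴ * (A - proj V A)) = 0 := by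
  rw [← inner_vec, map_sub, proj, LinearEquiv.apply_symm_apply]
  exact (Submodule.mem_orthogonal _ _).mp
    (Submodule.sub_starProjection_mem_orthogonal (vec A)) _ (Submodule.mem_map_of_mem hC)

/-- The purity `P_V(A) = Tr[A_V ^ 2]`. -/
def purity (V : Submodule ℝ (Matrix d d ℂ)) (A : Matrix d d ℂ) : ℂ :=
  Matrix.trace (proj V A ^ 2)

end LieCircuit

end

/-!
The design property is used for the single operator `ρ ⊗ ρ`: tested against `O ⊗ O` it gives the
second moment of the loss as a Haar average, and tested against `O ⊗ 1` it gives the mean, because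
`Tr ρ = 1` (`integral_loss_sq_eq`, `integral_loss_eq`). Compact groups are unimodular, so inverting
the group element exchanges the roles of `ρ` and `O`; one may therefore assume that the matrix acted
on is `i X` with `X ∈ 𝔤`, and write `B` for the other one.

The averages of `Im Tr[V x V† B]` and `Im Tr[V x V† B] * Im Tr[V y V† B]` over `V` are a linear form
and a symmetric bilinear form on matrices (`meanForm`, `secondMomentForm`) that are invariant under
the adjoint action of the group, hence, differentiating along one-parameter groups, infinitesimally
invariant under `𝔤`. Split `X` along the ideals of the decomposition. The central part is fixed by
the group. A simple ideal is spanned by its brackets, so the mean form vanishes on it and any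
invariant bilinear form vanishes between it and the other ideals
(`IsReductiveDecomposition.orthogonal`); this applies to the second moment and to the
Hilbert–Schmidt form, the latter identifying the projections of `i X` with its components. Only the
central part contributes to the mean, and its square to the second moment.

On a simple ideal the second moment is `c` times the Hilbert–Schmidt form by Schur's lemma
(`exists_eq_mul_of_invariant`). The constant is found by summing over an orthonormal basis `e`: the
Casimir tensor `∑ e i ⊗ e i` is invariant under the group (`sum_Ad_eq_of_infinitesimal`,
`sum_lie_orthonormal_eq_zero`), so that `∑ (Im Tr[V (e i) V† B])²` does not depend on `V`, and at
`V = 1` it is the purity of `B` (`purity_eq_sum`). Hence `c` times the dimension is this purity.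
-/

noncomputable section

namespace LieCircuit

variable {d : Type*} [Fintype d] [DecidableEq d]

set_option linter.unusedSectionVars false

/-! ### Differentiating along one-parameter groups -/

section Exp

open scoped Matrix.Norms.Operator

theorem continuous_matrix_exp :
    Continuous (NormedSpace.exp : Matrix d d ℂ → Matrix d d ℂ) :=
  NormedSpace.exp_continuous

theorem hasDerivAt_exp_conj (X x : Matrix d d ℂ) (t : ℝ) :
    HasDerivAt (fun s : ℝ => NormedSpace.exp (s • X) * x * NormedSpace.exp (-(s • X)))
      (NormedSpace.exp (t • X) * ⁅X, x⁆ * NormedSpace.exp (-(t • X))) t := by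
  have h1 := hasDerivAt_exp_smul_const (𝕂 := ℝ) X t
  have h2 := hasDerivAt_exp_smul_const' (𝕂 := ℝ) (-X) t
  have h := (h1.mul_const x).mul h2
  simp only [smul_neg] at h
  refine h.congr_deriv ?_
  rw [Ring.lie_def]
  noncomm_ring

theorem hasDerivAt_bilin (γ : Matrix d d ℂ →ₗ[ℝ] Matrix d d ℂ →ₗ[ℝ] ℝ)
    {u v : ℝ → Matrix d d ℂ} {u' v' : Matrix d d ℂ} {t : ℝ}
    (hu : HasDerivAt u u' t) (hv : HasDerivAt v v' t) :
    HasDerivAt (fun s => γ (u s) (v s)) (γ u' (v t) + γ (u t) v') t := by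
  have h := (γ.toContinuousBilinearMap.hasFDerivAt_of_bilinear hu.hasFDerivAt
    hv.hasFDerivAt).hasDerivAt
  refine h.congr_deriv ?_
  change γ (u t) ((1 : ℝ) • v') + γ ((1 : ℝ) • u') (v t) = _
  rw [one_smul, one_smul, add_comm]

theorem hasDerivAt_linear (a : Matrix d d ℂ →ₗ[ℝ] ℝ)
    {u : ℝ → Matrix d d ℂ} {u' : Matrix d d ℂ} {t : ℝ}
    (hu : HasDerivAt u u' t) : HasDerivAt (fun s => a (u s)) (a u') t :=
  (LinearMap.toContinuousLinearMap a).hasFDerivAt.comp_hasDerivAt t hu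

end Exp

/-! ### The adjoint action of the group -/

/-- The adjoint action `x ↦ V x V†` of the unitary group on all matrices, as a real-linear
representation. -/
def Ad : unitary (Matrix d d ℂ) →* Module.End ℝ (Matrix d d ℂ) where
  toFun V :=
    { toFun x := (V : Matrix d d ℂ) * x * (V : Matrix d d ℂ)ᴴ
      map_add' x y := by rw [mul_add, add_mul]
      map_smul' r x := by simp }
  map_one' := by ext1 x; simp
  map_mul' V W := by
    ext1 x
    simp [Matrix.conjTranspose_mul, mul_assoc]

theorem Ad_apply (V : unitary (Matrix d d ℂ)) (x : Matrix d d ℂ) :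
    Ad V x = (V : Matrix d d ℂ) * x * (V : Matrix d d ℂ)ᴴ := rfl

theorem continuous_Ad (x : Matrix d d ℂ) :
    Continuous fun V : unitary (Matrix d d ℂ) => Ad V x := by
  simp only [Ad_apply]
  fun_prop

theorem Ad_inv_Ad (V : unitary (Matrix d d ℂ)) (x : Matrix d d ℂ) : Ad V⁻¹ (Ad V x) = x := by
  rw [← Module.End.mul_apply, ← map_mul, inv_mul_cancel, map_one, Module.End.one_apply]

theorem exp_mem_unitary {X : Matrix d d ℂ} (hX : Xᴴ = -X) :
    NormedSpace.exp X ∈ unitary (Matrix d d ℂ) := by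
  have h1 := Matrix.exp_add_of_commute (-X) X (Commute.refl X).neg_left
  have h2 := Matrix.exp_add_of_commute X (-X) (Commute.refl X).neg_right
  rw [neg_add_cancel, NormedSpace.exp_zero] at h1
  rw [add_neg_cancel, NormedSpace.exp_zero] at h2
  rw [Unitary.mem_iff, Matrix.star_eq_conjTranspose, ← Matrix.exp_conjTranspose, hX]
  exact ⟨h1.symm, h2.symm⟩

/-- The exponential of a skew-Hermitian matrix as an element of the unitary group. -/
def expUnitary {X : Matrix d d ℂ} (hX : Xᴴ = -X) : unitary (Matrix d d ℂ) :=
  ⟨NormedSpace.exp X, exp_mem_unitary hX⟩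

theorem conjTranspose_real_smul {X : Matrix d d ℂ} (hX : Xᴴ = -X) (t : ℝ) :
    (t • X)ᴴ = -(t • X) := by
  rw [Matrix.conjTranspose_smul, hX, star_trivial, smul_neg]

theorem Ad_expUnitary {X : Matrix d d ℂ} (hX : Xᴴ = -X) (x : Matrix d d ℂ) :
    Ad (expUnitary hX) x = NormedSpace.exp X * x * NormedSpace.exp (-X) := by
  rw [Ad_apply, expUnitary, ← Matrix.exp_conjTranspose, hX]

theorem Ad_one_param_zero {X : Matrix d d ℂ} (hX : Xᴴ = -X) (x : Matrix d d ℂ) :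
    Ad (expUnitary (conjTranspose_real_smul hX 0)) x = x := by
  simp [Ad_expUnitary]

theorem hasDerivAt_Ad {X : Matrix d d ℂ} (hX : Xᴴ = -X) (x : Matrix d d ℂ) (t : ℝ) :
    HasDerivAt (fun s : ℝ => Ad (expUnitary (conjTranspose_real_smul hX s)) x)
      (Ad (expUnitary (conjTranspose_real_smul hX t)) ⁅X, x⁆) t := by
  simp only [Ad_expUnitary]
  exact hasDerivAt_exp_conj X x t

theorem expUnitary_mem_expGroup {𝔤 : LieSubalgebra ℝ (Matrix d d ℂ)} {X : Matrix d d ℂ}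
    (hX : Xᴴ = -X) (hmem : X ∈ 𝔤) : expUnitary hX ∈ expGroup 𝔤 :=
  Subgroup.le_topologicalClosure _ (Subgroup.subset_closure ⟨X, hmem, rfl⟩)

/-- A closed subset of the unitary group that contains the exponentials of `𝔤` and is closed under
the group operations contains the group generated by `𝔤`. -/
theorem expGroup_induction {𝔤 : LieSubalgebra ℝ (Matrix d d ℂ)}
    (hskew : ∀ X ∈ 𝔤, Xᴴ = -X) {p : unitary (Matrix d d ℂ) → Prop}
    (hexp : ∀ X (hX : X ∈ 𝔤), p (expUnitary (hskew X hX))) (hone : p 1)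
    (hmul : ∀ V W, p V → p W → p (V * W)) (hinv : ∀ V, p V → p V⁻¹)
    (hclosed : IsClosed {V | p V}) {V : unitary (Matrix d d ℂ)} (hV : V ∈ expGroup 𝔤) : p V := by
  let K : Subgroup (unitary (Matrix d d ℂ)) :=
    { carrier := {V | p V}
      mul_mem' := fun {V W} hV hW => hmul V W hV hW
      one_mem' := hone
      inv_mem' := fun {V} hV => hinv V hV }
  have hK : expGroup 𝔤 ≤ K := by
    refine Subgroup.topologicalClosure_minimal _ ((Subgroup.closure_le K).mpr ?_) hclosed
    rintro V ⟨X, hX, hVX⟩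
    have : V = expUnitary (hskew X hX) := Subtype.ext hVX
    rw [this]
    exact hexp X hX
  exact hK hV

/-- A linear functional invariant under the one-parameter group of `X` vanishes on brackets
with `X`. -/
theorem map_lie_eq_zero_of_Ad_invariant (a : Matrix d d ℂ →ₗ[ℝ] ℝ) {X : Matrix d d ℂ}
    (hX : Xᴴ = -X)
    (ha : ∀ (t : ℝ) (x : Matrix d d ℂ),
      a (Ad (expUnitary (conjTranspose_real_smul hX t)) x) = a x)
    (x : Matrix d d ℂ) : a ⁅X, x⁆ = 0 := by
  have h := hasDerivAt_linear a (hasDerivAt_Ad hX x 0)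
  simp only [ha] at h
  exact h.unique (hasDerivAt_const 0 (a x))

/-- A bilinear form invariant under the one-parameter group of `X` is infinitesimally invariant
under `X`. -/
theorem map_lie_add_map_lie_eq_zero_of_Ad_invariant
    (γ : Matrix d d ℂ →ₗ[ℝ] Matrix d d ℂ →ₗ[ℝ] ℝ) {X : Matrix d d ℂ} (hX : Xᴴ = -X)
    (hγ : ∀ (t : ℝ) (x y : Matrix d d ℂ),
      γ (Ad (expUnitary (conjTranspose_real_smul hX t)) x)
        (Ad (expUnitary (conjTranspose_real_smul hX t)) y) = γ x y)
    (x y : Matrix d d ℂ) : γ ⁅X, x⁆ y + γ x ⁅X, y⁆ = 0 := by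
  have h := hasDerivAt_bilin γ (hasDerivAt_Ad hX x 0) (hasDerivAt_Ad hX y 0)
  simp only [hγ] at h
  exact h.unique (hasDerivAt_const 0 (γ x y))

/-- The group generated by `𝔤` fixes every matrix that commutes with `𝔤`. -/
theorem Ad_eq_self_of_lie_eq_zero {𝔤 : LieSubalgebra ℝ (Matrix d d ℂ)}
    (hskew : ∀ X ∈ 𝔤, Xᴴ = -X) {z : Matrix d d ℂ} (hz : ∀ X ∈ 𝔤, ⁅X, z⁆ = 0)
    {V : unitary (Matrix d d ℂ)} (hV : V ∈ expGroup 𝔤) : Ad V z = z := by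
  refine expGroup_induction hskew (p := fun V => Ad V z = z) ?_ ?_ ?_ ?_ ?_ hV
  · intro X hX
    have hc : Commute X z := by
      have := hz X hX
      rwa [Ring.lie_def, sub_eq_zero] at this
    have h1 : Commute (NormedSpace.exp X) z := by
      open scoped Matrix.Norms.Operator in
      exact hc.exp_left
    change NormedSpace.exp X * z * (NormedSpace.exp X)ᴴ = z
    rw [h1.eq, mul_assoc]
    have := (Unitary.mem_iff.mp (exp_mem_unitary (hskew X hX))).2
    rw [Matrix.star_eq_conjTranspose] at this
    rw [this, mul_one]
  · simp
  · intro V W hV hW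
    rw [map_mul, Module.End.mul_apply, hW, hV]
  · intro V hV
    conv_lhs => rw [← hV]
    exact Ad_inv_Ad V z
  · exact isClosed_eq (continuous_Ad z) continuous_const

/-- If the symmetric tensor `∑ e i ⊗ e i` is annihilated by `𝔤`, then it is fixed by the group
generated by `𝔤`. Tensors are encoded by their pairings with bilinear forms. -/
theorem sum_Ad_eq_of_infinitesimal {𝔤 : LieSubalgebra ℝ (Matrix d d ℂ)}
    (hskew : ∀ X ∈ 𝔤, Xᴴ = -X) {ι : Type*} [Fintype ι] (e : ι → Matrix d d ℂ)
    (he : ∀ X ∈ 𝔤, ∀ γ : Matrix d d ℂ →ₗ[ℝ] Matrix d d ℂ →ₗ[ℝ] ℝ,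
      ∑ i, (γ ⁅X, e i⁆ (e i) + γ (e i) ⁅X, e i⁆) = 0)
    {V : unitary (Matrix d d ℂ)} (hV : V ∈ expGroup 𝔤)
    (γ : Matrix d d ℂ →ₗ[ℝ] Matrix d d ℂ →ₗ[ℝ] ℝ) :
    ∑ i, γ (Ad V (e i)) (Ad V (e i)) = ∑ i, γ (e i) (e i) := by
  refine expGroup_induction hskew (p := fun V => ∀ γ : Matrix d d ℂ →ₗ[ℝ] Matrix d d ℂ →ₗ[ℝ] ℝ,
    ∑ i, γ (Ad V (e i)) (Ad V (e i)) = ∑ i, γ (e i) (e i)) ?_ ?_ ?_ ?_ ?_ hV γ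
  · intro X hX γ
    have hsk := hskew X hX
    set A : ℝ → Module.End ℝ (Matrix d d ℂ) :=
      fun s => Ad (expUnitary (conjTranspose_real_smul hsk s)) with hA
    have hderiv (t : ℝ) : HasDerivAt (fun s => ∑ i, γ (A s (e i)) (A s (e i))) 0 t := by
      have h : HasDerivAt (fun s => ∑ i, γ (A s (e i)) (A s (e i)))
          (∑ i, (γ (A t ⁅X, e i⁆) (A t (e i)) + γ (A t (e i)) (A t ⁅X, e i⁆))) t :=
        HasDerivAt.fun_sum fun i _ =>
          hasDerivAt_bilin γ (hasDerivAt_Ad hsk (e i) t) (hasDerivAt_Ad hsk (e i) t)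
      rwa [← he X hX (γ.compl₁₂ (A t) (A t))]
    have hconst : ∑ i, γ (A 1 (e i)) (A 1 (e i)) = ∑ i, γ (A 0 (e i)) (A 0 (e i)) :=
      is_const_of_deriv_eq_zero (fun t => (hderiv t).differentiableAt)
        (fun t => (hderiv t).deriv) 1 0
    have h0 (x : Matrix d d ℂ) : A 0 x = x := Ad_one_param_zero hsk x
    have h1 (x : Matrix d d ℂ) : A 1 x = Ad (expUnitary hsk) x := by
      simp only [hA, Ad_expUnitary, one_smul]
    simpa only [h0, h1] using hconst
  · simp
  · intro V W hV hW γ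
    simp only [map_mul, Module.End.mul_apply]
    have h1 := hW (γ.compl₁₂ (Ad V) (Ad V))
    simp only [LinearMap.compl₁₂_apply] at h1
    rw [h1, hV]
  · intro V hV γ
    have h1 := hV (γ.compl₁₂ (Ad V⁻¹) (Ad V⁻¹))
    simp only [LinearMap.compl₁₂_apply, Ad_inv_Ad] at h1
    exact h1.symm
  · simp only [Set.ofPred_forall]
    refine isClosed_iInter fun γ => isClosed_eq (continuous_finsetSum _ fun i _ => ?_)
      continuous_const
    have h : Continuous fun p : Matrix d d ℂ × Matrix d d ℂ => γ p.1 p.2 := by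
      open scoped Matrix.Norms.Operator in
      exact γ.toContinuousBilinearMap.continuous₂
    exact h.comp ((continuous_Ad (e i)).prodMk (continuous_Ad (e i)))

/-! ### Haar measure on the generated group -/

instance instIsProbabilityMeasureHaar (𝔤 : LieSubalgebra ℝ (Matrix d d ℂ)) :
    IsProbabilityMeasure (haar 𝔤) :=
  ⟨Measure.haarMeasure_self (K₀ := (⊤ : TopologicalSpace.PositiveCompacts (expGroup 𝔤)))⟩

instance instIsHaarMeasureHaar (𝔤 : LieSubalgebra ℝ (Matrix d d ℂ)) :
    (haar 𝔤).IsHaarMeasure :=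
  Measure.isHaarMeasure_haarMeasure _

section Compact

variable {G : Type*} [Group G] [TopologicalSpace G] [IsTopologicalGroup G] [CompactSpace G]
  [MeasurableSpace G] [BorelSpace G]

/-- On a compact group a left-invariant probability measure is unique. -/
theorem eq_of_isMulLeftInvariant (ν μ : Measure G) [μ.IsHaarMeasure] [IsProbabilityMeasure μ]
    [ν.IsMulLeftInvariant] [IsProbabilityMeasure ν] : ν = μ := by
  have h := Measure.isMulInvariant_eq_smul_of_compactSpace ν μ
  have h1 : ν Set.univ = (Measure.haarScalarFactor ν μ • μ) Set.univ := by rw [← h]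
  simp only [Measure.smul_apply, measure_univ] at h1
  have h2 : Measure.haarScalarFactor ν μ = 1 := by
    have : (1 : ENNReal) = (Measure.haarScalarFactor ν μ : ENNReal) := by
      simpa [ENNReal.smul_def] using h1
    exact_mod_cast this.symm
  rw [h, h2, one_smul]

/-- Compact groups are unimodular. -/
theorem isMulRightInvariant_of_compactSpace (μ : Measure G) [μ.IsHaarMeasure]
    [IsProbabilityMeasure μ] : μ.IsMulRightInvariant where
  map_mul_right_eq_self g := by
    have hm : Measurable (fun x : G => x * g) := (continuous_mul_const g).measurable
    have : IsProbabilityMeasure (μ.map (· * g)) :=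
      Measure.isProbabilityMeasure_map hm.aemeasurable
    have : (μ.map (· * g)).IsMulLeftInvariant := by
      constructor
      intro h
      have hm' : Measurable (fun x : G => h * x) := (continuous_const_mul h).measurable
      rw [Measure.map_map hm' hm]
      conv_rhs => rw [← map_mul_left_eq_self μ h, Measure.map_map hm hm']
      congr 1
      ext x
      simp [mul_assoc]
    exact eq_of_isMulLeftInvariant _ μ

theorem isInvInvariant_of_compactSpace (μ : Measure G) [μ.IsHaarMeasure]
    [IsProbabilityMeasure μ] : μ.IsInvInvariant where
  inv_eq_self := by
    have : μ.IsMulRightInvariant := isMulRightInvariant_of_compactSpace μ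
    have : IsProbabilityMeasure μ.inv :=
      Measure.isProbabilityMeasure_map continuous_inv.measurable.aemeasurable
    exact eq_of_isMulLeftInvariant _ μ

end Compact

instance instIsMulRightInvariantHaar (𝔤 : LieSubalgebra ℝ (Matrix d d ℂ)) :
    (haar 𝔤).IsMulRightInvariant :=
  isMulRightInvariant_of_compactSpace _

instance instIsInvInvariantHaar (𝔤 : LieSubalgebra ℝ (Matrix d d ℂ)) :
    (haar 𝔤).IsInvInvariant :=
  isInvInvariant_of_compactSpace _

/-! ### Invariant forms on simple Lie algebras -/

section Simple

variable {S : Type*} [LieRing S] [LieAlgebra ℝ S]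

/-- A simple Lie algebra is spanned by its brackets. -/
theorem eq_zero_of_map_lie_eq_zero [LieAlgebra.IsSimple ℝ S] (f : S →ₗ[ℝ] ℝ)
    (hf : ∀ x y : S, f ⁅x, y⁆ = 0) (x : S) : f x = 0 := by
  have htop : (⁅(⊤ : LieIdeal ℝ S), (⊤ : LieIdeal ℝ S)⁆ : LieIdeal ℝ S) = ⊤ := by
    refine (LieAlgebra.IsSimple.eq_bot_or_eq_top (R := ℝ) _).resolve_left fun hbot => ?_
    refine LieAlgebra.IsSimple.non_abelian (R := ℝ) (L := S) ⟨fun x y => ?_⟩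
    have : ⁅x, y⁆ ∈ (⁅(⊤ : LieIdeal ℝ S), (⊤ : LieIdeal ℝ S)⁆ : LieIdeal ℝ S) :=
      LieSubmodule.lie_mem_lie (LieSubmodule.mem_top x) (LieSubmodule.mem_top y)
    rwa [hbot, LieSubmodule.mem_bot] at this
  have hle : (⁅(⊤ : LieIdeal ℝ S), (⊤ : LieIdeal ℝ S)⁆ : LieIdeal ℝ S).toSubmodule
      ≤ LinearMap.ker f := by
    rw [LieSubmodule.lieIdeal_oper_eq_linear_span', Submodule.span_le]
    rintro _ ⟨a, -, b, -, rfl⟩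
    exact hf a b
  rw [htop] at hle
  exact hle (Submodule.mem_top (x := x))

theorem exists_orthonormal_basis {V : Type*} [AddCommGroup V] [Module ℝ V]
    [FiniteDimensional ℝ V] (q : V →ₗ[ℝ] V →ₗ[ℝ] ℝ) (hsymm : ∀ x y, q x y = q y x)
    (hpos : ∀ x, x ≠ 0 → 0 < q x x) :
    ∃ e : Module.Basis (Fin (Module.finrank ℝ V)) ℝ V,
      ∀ i j, q (e i) (e j) = if i = j then 1 else 0 := by
  obtain ⟨v, hv⟩ := LinearMap.BilinForm.exists_orthogonal_basis (B := q)
    ⟨fun x y => hsymm x y⟩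
  have hq (i) : 0 < q (v i) (v i) := hpos _ (v.ne_zero i)
  have hs (i) : Real.sqrt (q (v i) (v i)) ≠ 0 := (Real.sqrt_pos.mpr (hq i)).ne'
  refine ⟨v.isUnitSMul (w := fun i => (Real.sqrt (q (v i) (v i)))⁻¹)
    fun i => (inv_ne_zero (hs i)).isUnit, fun i j => ?_⟩
  rw [Module.Basis.isUnitSMul_apply, Module.Basis.isUnitSMul_apply, map_smul, map_smul,
    LinearMap.smul_apply, smul_eq_mul, smul_eq_mul]
  split_ifs with h
  · subst h
    have := Real.mul_self_sqrt (hq i).le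
    have hi := hs i
    field_simp
    nlinarith
  · rw [show q (v i) (v j) = 0 from hv h]
    simp

/-- The coordinates in an orthonormal basis. -/
theorem eq_sum_of_orthonormal {V : Type*} [AddCommGroup V] [Module ℝ V] {ι : Type*} [Fintype ι]
    [DecidableEq ι] (q : V →ₗ[ℝ] V →ₗ[ℝ] ℝ) (e : Module.Basis ι ℝ V)
    (he : ∀ i j, q (e i) (e j) = if i = j then 1 else 0) (x : V) :
    x = ∑ i, q (e i) x • e i := by
  have h (i) : q (e i) x = e.repr x i := by
    conv_lhs => rw [← e.sum_repr x]
    simp only [map_sum, map_smul, he, smul_eq_mul, mul_ite, mul_one, mul_zero, Finset.sum_ite_eq,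
      Finset.mem_univ, if_true]
  simp only [h, e.sum_repr]

/-- **Schur's lemma** for forms: on a simple real Lie algebra with an invariant inner product `q`,
every invariant symmetric form is a multiple of `q`. A symmetric form `β` has a real eigenvalue
`c` with respect to `q`, and the radical of `β - c q` is then a nonzero ideal. -/
theorem exists_eq_mul_of_invariant [LieAlgebra.IsSimple ℝ S] [FiniteDimensional ℝ S]
    (q β : S →ₗ[ℝ] S →ₗ[ℝ] ℝ) (hqs : ∀ x y, q x y = q y x) (hqp : ∀ x, x ≠ 0 → 0 < q x x)
    (hqi : ∀ a x y : S, q ⁅a, x⁆ y + q x ⁅a, y⁆ = 0) (hβs : ∀ x y, β x y = β y x)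
    (hβi : ∀ a x y : S, β ⁅a, x⁆ y + β x ⁅a, y⁆ = 0) : ∃ c : ℝ, ∀ x y, β x y = c * q x y := by
  obtain ⟨e, he⟩ := exists_orthonormal_basis q hqs hqp
  have hnt : Nontrivial S := by
    by_contra h
    rw [not_nontrivial_iff_subsingleton] at h
    exact LieAlgebra.IsSimple.non_abelian (R := ℝ) (L := S) ⟨fun x y => Subsingleton.elim _ _⟩
  have hfr : 0 < Module.finrank ℝ S := Module.finrank_pos
  let A : Matrix (Fin (Module.finrank ℝ S)) (Fin (Module.finrank ℝ S)) ℝ :=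
    Matrix.of fun i j => β (e i) (e j)
  have hA : A.IsHermitian := by
    ext i j
    simp [A, hβs (e j) (e i)]
  let i₀ : Fin (Module.finrank ℝ S) := ⟨0, hfr⟩
  set c := hA.eigenvalues i₀ with hc
  set w : Fin (Module.finrank ℝ S) → ℝ := ⇑(hA.eigenvectorBasis i₀) with hw
  have hAw : A *ᵥ w = c • w := hA.mulVec_eigenvectorBasis i₀
  have hw0 : w ≠ 0 := by
    intro h
    apply hA.eigenvectorBasis.toBasis.ne_zero i₀
    ext k
    simpa using congrFun h k
  let I : LieIdeal ℝ S :=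
    { LinearMap.ker (β - c • q) with
      lie_mem := by
        intro a x hx
        have hx' : ∀ y, β x y - c * q x y = 0 := fun y => by
          simpa using LinearMap.congr_fun (LinearMap.mem_ker.mp hx) y
        refine LinearMap.mem_ker.mpr (LinearMap.ext fun y => ?_)
        simp only [LinearMap.sub_apply, LinearMap.smul_apply, smul_eq_mul, LinearMap.zero_apply]
        linear_combination hβi a x y - c * hqi a x y - hx' ⁅a, y⁆ }
  have hmem (x : S) : x ∈ I ↔ (β - c • q) x = 0 := Iff.rfl
  have hI : I ≠ ⊥ := by
    intro hbot
    have hx : (∑ i, w i • e i) ∈ I := by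
      rw [hmem]
      refine e.ext fun j => ?_
      have := congrFun hAw j
      simp only [Matrix.mulVec, dotProduct, A, Matrix.of_apply, Pi.smul_apply, smul_eq_mul] at this
      have h1 : β (∑ i, w i • e i) (e j) = c * w j := by
        rw [← this, map_sum, LinearMap.sum_apply]
        exact Finset.sum_congr rfl fun i _ => by
          rw [map_smul, LinearMap.smul_apply, smul_eq_mul, hβs, mul_comm]
      have h2 : q (∑ i, w i • e i) (e j) = w j := by simp [he]
      simp only [LinearMap.sub_apply, LinearMap.smul_apply, smul_eq_mul, h1, h2, sub_self,
        LinearMap.zero_apply]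
    rw [hbot, LieSubmodule.mem_bot] at hx
    exact hw0 (funext fun i => Fintype.linearIndependent_iff.mp e.linearIndependent w hx i)
  have hItop := (LieAlgebra.IsSimple.eq_bot_or_eq_top (R := ℝ) I).resolve_left hI
  refine ⟨c, fun x y => ?_⟩
  have hx : x ∈ I := hItop ▸ LieSubmodule.mem_top x
  have := LinearMap.congr_fun ((hmem x).mp hx) y
  simpa [sub_eq_zero] using this

end Simple

/-! ### The Hilbert–Schmidt form and orthogonal projections -/

/-- The Hilbert–Schmidt inner product of skew-Hermitian matrices, `-Tr[x y]`, as a real-bilinear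
form on all matrices. -/
def hsForm : Matrix d d ℂ →ₗ[ℝ] Matrix d d ℂ →ₗ[ℝ] ℝ :=
  LinearMap.mk₂ ℝ (fun x y => -(Matrix.trace (x * y)).re)
    (fun x y z => by simp [add_mul]; ring) (fun r x y => by simp)
    (fun x y z => by simp [mul_add]; ring) (fun r x y => by simp)

theorem hsForm_apply (x y : Matrix d d ℂ) : hsForm x y = -(Matrix.trace (x * y)).re := rfl

/-- `Im Tr[x B]` as a real-linear functional of `x`; it is `-i Tr[x B]` for `x` skew-Hermitian and
`B` Hermitian. -/
def imTrace (B : Matrix d d ℂ) : Matrix d d ℂ →ₗ[ℝ] ℝ where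
  toFun x := (Matrix.trace (x * B)).im
  map_add' x y := by simp [add_mul]
  map_smul' r x := by simp

theorem imTrace_apply (B x : Matrix d d ℂ) : imTrace B x = (Matrix.trace (x * B)).im := rfl

theorem hsForm_comm (x y : Matrix d d ℂ) : hsForm x y = hsForm y x := by
  rw [hsForm_apply, hsForm_apply, Matrix.trace_mul_comm]

theorem hsForm_lie (a x y : Matrix d d ℂ) : hsForm ⁅a, x⁆ y + hsForm x ⁅a, y⁆ = 0 := by
  have h : Matrix.trace (⁅a, x⁆ * y) + Matrix.trace (x * ⁅a, y⁆) = 0 := by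
    simp only [Ring.lie_def, sub_mul, mul_sub, Matrix.trace_sub]
    rw [mul_assoc a x y, Matrix.trace_mul_comm a (x * y)]
    simp only [mul_assoc]
    ring
  have := congrArg Complex.re h
  simp only [Complex.add_re, Complex.zero_re] at this
  simp only [hsForm_apply]
  linarith

theorem trace_mul_eq_neg_hsForm {x y : Matrix d d ℂ} (hx : xᴴ = -x) (hy : yᴴ = -y) :
    Matrix.trace (x * y) = -(hsForm x y : ℂ) := by
  have h : starRingEnd ℂ (Matrix.trace (x * y)) = Matrix.trace (x * y) := by
    rw [starRingEnd_apply, ← Matrix.trace_conjTranspose, Matrix.conjTranspose_mul, hx, hy,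
      neg_mul_neg, Matrix.trace_mul_comm]
  rw [hsForm_apply, Complex.ofReal_neg, neg_neg, Complex.conj_eq_iff_re.mp h]

theorem hsForm_pos {x : Matrix d d ℂ} (hx : xᴴ = -x) (h0 : x ≠ 0) : 0 < hsForm x x := by
  have h := inner_vec x x
  have h1 : (0 : ℝ) < ‖vec x‖ ^ 2 := by
    have : vec x ≠ 0 := by simpa using h0
    positivity
  rw [hx, neg_mul, Matrix.trace_neg, trace_mul_eq_neg_hsForm hx hx, neg_neg,
    inner_self_eq_norm_sq_to_K] at h
  have h2 : ‖vec x‖ ^ 2 = hsForm x x := by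
    apply Complex.ofReal_injective
    simpa using h
  rwa [← h2]

theorem trace_mul_eq_I_mul_imTrace {x B : Matrix d d ℂ} (hx : xᴴ = -x) (hB : B.IsHermitian) :
    Matrix.trace (x * B) = Complex.I * (imTrace B x : ℂ) := by
  have h : starRingEnd ℂ (Matrix.trace (x * B)) = -Matrix.trace (x * B) := by
    rw [starRingEnd_apply, ← Matrix.trace_conjTranspose, Matrix.conjTranspose_mul, hx, hB.eq,
      mul_neg, Matrix.trace_neg, Matrix.trace_mul_comm]
  have hre := congrArg Complex.re h
  simp only [Complex.conj_re, Complex.neg_re] at hre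
  apply Complex.ext
  · simp only [Complex.mul_re, Complex.I_re, Complex.ofReal_re, Complex.I_im, Complex.ofReal_im]
    linarith
  · simp [imTrace_apply]

theorem proj_eq_of_orthogonal (V : Submodule ℝ (Matrix d d ℂ)) {A p : Matrix d d ℂ}
    (hp : p ∈ Submodule.span ℂ (V : Set (Matrix d d ℂ)))
    (h : ∀ C ∈ V, Matrix.trace (Cᴴ * (A - p)) = 0) : proj V A = p := by
  have h' : ∀ C ∈ Submodule.span ℂ (V : Set (Matrix d d ℂ)),
      Matrix.trace (Cᴴ * (A - p)) = 0 := by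
    intro C hC
    induction hC using Submodule.span_induction with
    | mem x hx => exact h x hx
    | zero => simp
    | add x y _ _ hx hy =>
      rw [Matrix.conjTranspose_add, add_mul, Matrix.trace_add, hx, hy, add_zero]
    | smul r x _ hx =>
      rw [Matrix.conjTranspose_smul, Matrix.smul_mul, Matrix.trace_smul, hx, smul_zero]
  have hD := Submodule.sub_mem _ (proj_mem V A) hp
  have h1 := h' _ hD
  have h2 := trace_sub_proj V A hD
  have h3 : Matrix.trace ((proj V A - p)ᴴ * (proj V A - p)) = 0 := by
    rw [show proj V A - p = (A - p) - (A - proj V A) by abel, mul_sub, Matrix.trace_sub]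
    rw [show (A - p) - (A - proj V A) = proj V A - p by abel, h1, h2, sub_zero]
  exact sub_eq_zero.mp (Matrix.trace_conjTranspose_mul_self_eq_zero_iff.mp h3)

/-- The trace of a product of projections, with one argument already in the subspace. -/
theorem trace_mul_proj {V : Submodule ℝ (Matrix d d ℂ)} (hV : ∀ x ∈ V, xᴴ = -x)
    {x : Matrix d d ℂ} (hx : x ∈ V) (A : Matrix d d ℂ) :
    Matrix.trace (x * proj V A) = Matrix.trace (x * A) := by
  have h := trace_sub_proj V A (Submodule.subset_span hx)
  rw [hV x hx, neg_mul, Matrix.trace_neg, neg_eq_zero, mul_sub, Matrix.trace_sub,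
    sub_eq_zero] at h
  exact h.symm

/-- If `x ∈ V` and `y` is orthogonal to `V`, the projection of `i (x + y)` to `V` is `i x`. -/
theorem proj_I_smul_add {V : Submodule ℝ (Matrix d d ℂ)} (hV : ∀ x ∈ V, xᴴ = -x)
    {x y : Matrix d d ℂ} (hx : x ∈ V) (hy : yᴴ = -y) (hxy : ∀ v ∈ V, hsForm v y = 0) :
    proj V (Complex.I • (x + y)) = Complex.I • x := by
  refine proj_eq_of_orthogonal V (Submodule.smul_mem _ _ (Submodule.subset_span hx)) ?_
  intro C hC
  rw [smul_add, add_sub_cancel_left, hV C hC, Matrix.mul_smul, Matrix.trace_smul, neg_mul,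
    Matrix.trace_neg, trace_mul_eq_neg_hsForm (hV C hC) hy, hxy C hC]
  simp

/-- The purity of a Hermitian matrix in an orthonormal basis of a space of skew-Hermitian
matrices. -/
theorem purity_eq_sum {V : Submodule ℝ (Matrix d d ℂ)} (hV : ∀ x ∈ V, xᴴ = -x) {ι : Type*}
    [Fintype ι] [DecidableEq ι] {e : ι → Matrix d d ℂ} (hmem : ∀ i, e i ∈ V)
    (he : ∀ i j, hsForm (e i) (e j) = if i = j then 1 else 0)
    (hspan : ∀ x ∈ V, x = ∑ i, hsForm (e i) x • e i) {A : Matrix d d ℂ} (hA : A.IsHermitian) :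
    purity V A = ((∑ i, imTrace A (e i) ^ 2 : ℝ) : ℂ) := by
  have htr (i j) : Matrix.trace (e i * e j) = if i = j then -1 else 0 := by
    rw [trace_mul_eq_neg_hsForm (hV _ (hmem i)) (hV _ (hmem j)), he]
    split_ifs <;> simp
  have hproj : proj V A = ∑ i, (-(Complex.I * (imTrace A (e i) : ℂ))) • e i := by
    refine proj_eq_of_orthogonal V
      (Submodule.sum_mem _ fun i _ => Submodule.smul_mem _ _ (Submodule.subset_span (hmem i))) ?_
    have hbasis (k) : Matrix.trace (e k *
        (A - ∑ i, (-(Complex.I * (imTrace A (e i) : ℂ))) • e i)) = 0 := by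
      rw [mul_sub, Matrix.trace_sub, trace_mul_eq_I_mul_imTrace (hV _ (hmem k)) hA,
        Finset.mul_sum, Matrix.trace_sum]
      simp [htr]
    intro C hC
    rw [hV C hC, hspan C hC, neg_mul, Matrix.trace_neg, neg_eq_zero, Finset.sum_mul,
      Matrix.trace_sum]
    refine Finset.sum_eq_zero fun k _ => ?_
    rw [Matrix.smul_mul, Matrix.trace_smul, hbasis, smul_zero]
  rw [purity, hproj, pow_two, Finset.sum_mul, Matrix.trace_sum, Complex.ofReal_sum]
  refine Finset.sum_congr rfl fun i _ => ?_
  rw [Finset.mul_sum, Matrix.trace_sum]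
  simp only [Matrix.smul_mul, Matrix.mul_smul, Matrix.trace_smul, htr, smul_eq_mul]
  simp
  linear_combination (-(imTrace A (e i) : ℂ) ^ 2) * Complex.I_mul_I

/-! ### Averages over the group -/

theorem integrable_haar {𝔤 : LieSubalgebra ℝ (Matrix d d ℂ)} {E : Type*} [NormedAddCommGroup E]
    {f : expGroup 𝔤 → E} (hf : Continuous f) : Integrable f (haar 𝔤) :=
  hf.integrable_of_hasCompactSupport (HasCompactSupport.of_compactSpace f)

theorem continuous_imTrace_Ad (𝔤 : LieSubalgebra ℝ (Matrix d d ℂ)) (B x : Matrix d d ℂ) :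
    Continuous fun V : expGroup 𝔤 => imTrace B (Ad (V : unitary (Matrix d d ℂ)) x) :=
  (LinearMap.continuous_of_finiteDimensional (imTrace B)).comp
    ((continuous_Ad x).comp continuous_subtype_val)

/-- The average over the group generated by `𝔤` of `Im Tr[V x V† B]`. -/
def meanForm (𝔤 : LieSubalgebra ℝ (Matrix d d ℂ)) (B : Matrix d d ℂ) : Matrix d d ℂ →ₗ[ℝ] ℝ where
  toFun x := ∫ V : expGroup 𝔤, imTrace B (Ad (V : unitary (Matrix d d ℂ)) x) ∂haar 𝔤
  map_add' x y := by
    simp only [map_add]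
    exact integral_add (integrable_haar (continuous_imTrace_Ad 𝔤 B x))
      (integrable_haar (continuous_imTrace_Ad 𝔤 B y))
  map_smul' r x := by
    simp only [map_smul, smul_eq_mul, RingHom.id_apply]
    exact integral_const_mul _ _

theorem integrable_imTrace_mul (𝔤 : LieSubalgebra ℝ (Matrix d d ℂ)) (B x y : Matrix d d ℂ) :
    Integrable (fun V : expGroup 𝔤 => imTrace B (Ad (V : unitary (Matrix d d ℂ)) x) *
      imTrace B (Ad (V : unitary (Matrix d d ℂ)) y)) (haar 𝔤) :=
  integrable_haar ((continuous_imTrace_Ad 𝔤 B x).mul (continuous_imTrace_Ad 𝔤 B y))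

/-- The average over the group generated by `𝔤` of `Im Tr[V x V† B] * Im Tr[V y V† B]`. -/
def secondMomentForm (𝔤 : LieSubalgebra ℝ (Matrix d d ℂ)) (B : Matrix d d ℂ) :
    Matrix d d ℂ →ₗ[ℝ] Matrix d d ℂ →ₗ[ℝ] ℝ :=
  LinearMap.mk₂ ℝ (fun x y => ∫ V : expGroup 𝔤, imTrace B (Ad (V : unitary (Matrix d d ℂ)) x) *
      imTrace B (Ad (V : unitary (Matrix d d ℂ)) y) ∂haar 𝔤)
    (fun x y z => by
      simp only [map_add, add_mul]
      exact integral_add (integrable_imTrace_mul 𝔤 B x z) (integrable_imTrace_mul 𝔤 B y z))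
    (fun r x y => by
      simp only [map_smul, smul_eq_mul, mul_assoc]
      exact integral_const_mul _ _)
    (fun x y z => by
      simp only [map_add, mul_add]
      exact integral_add (integrable_imTrace_mul 𝔤 B x y) (integrable_imTrace_mul 𝔤 B x z))
    (fun r x y => by
      simp only [map_smul, smul_eq_mul, mul_left_comm _ r]
      exact integral_const_mul _ _)

theorem meanForm_apply (𝔤 : LieSubalgebra ℝ (Matrix d d ℂ)) (B x : Matrix d d ℂ) :
    meanForm 𝔤 B x = ∫ V : expGroup 𝔤, imTrace B (Ad (V : unitary (Matrix d d ℂ)) x) ∂haar 𝔤 :=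
  rfl

theorem secondMomentForm_apply (𝔤 : LieSubalgebra ℝ (Matrix d d ℂ)) (B x y : Matrix d d ℂ) :
    secondMomentForm 𝔤 B x y =
      ∫ V : expGroup 𝔤, imTrace B (Ad (V : unitary (Matrix d d ℂ)) x) *
        imTrace B (Ad (V : unitary (Matrix d d ℂ)) y) ∂haar 𝔤 :=
  rfl

theorem secondMomentForm_comm (𝔤 : LieSubalgebra ℝ (Matrix d d ℂ)) (B x y : Matrix d d ℂ) :
    secondMomentForm 𝔤 B x y = secondMomentForm 𝔤 B y x := by
  simp only [secondMomentForm_apply, mul_comm]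

theorem meanForm_Ad {𝔤 : LieSubalgebra ℝ (Matrix d d ℂ)} (B x : Matrix d d ℂ)
    {W : unitary (Matrix d d ℂ)} (hW : W ∈ expGroup 𝔤) :
    meanForm 𝔤 B (Ad W x) = meanForm 𝔤 B x := by
  simp only [meanForm_apply]
  conv_rhs => rw [← integral_mul_right_eq_self _ (⟨W, hW⟩ : expGroup 𝔤)]
  simp only [Subgroup.coe_mul, map_mul, Module.End.mul_apply]

theorem secondMomentForm_Ad {𝔤 : LieSubalgebra ℝ (Matrix d d ℂ)} (B x y : Matrix d d ℂ)
    {W : unitary (Matrix d d ℂ)} (hW : W ∈ expGroup 𝔤) :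
    secondMomentForm 𝔤 B (Ad W x) (Ad W y) = secondMomentForm 𝔤 B x y := by
  simp only [secondMomentForm_apply]
  conv_rhs => rw [← integral_mul_right_eq_self _ (⟨W, hW⟩ : expGroup 𝔤)]
  simp only [Subgroup.coe_mul, map_mul, Module.End.mul_apply]

theorem meanForm_lie {𝔤 : LieSubalgebra ℝ (Matrix d d ℂ)} (hskew : ∀ X ∈ 𝔤, Xᴴ = -X)
    (B : Matrix d d ℂ) {a : Matrix d d ℂ} (ha : a ∈ 𝔤) (x : Matrix d d ℂ) :
    meanForm 𝔤 B ⁅a, x⁆ = 0 :=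
  map_lie_eq_zero_of_Ad_invariant _ (hskew a ha)
    (fun t x => meanForm_Ad B x (expUnitary_mem_expGroup _ (𝔤.smul_mem t ha))) x

theorem secondMomentForm_lie {𝔤 : LieSubalgebra ℝ (Matrix d d ℂ)}
    (hskew : ∀ X ∈ 𝔤, Xᴴ = -X) (B : Matrix d d ℂ) {a : Matrix d d ℂ} (ha : a ∈ 𝔤)
    (x y : Matrix d d ℂ) :
    secondMomentForm 𝔤 B ⁅a, x⁆ y + secondMomentForm 𝔤 B x ⁅a, y⁆ = 0 :=
  map_lie_add_map_lie_eq_zero_of_Ad_invariant _ (hskew a ha)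
    (fun t x y => secondMomentForm_Ad B x y (expUnitary_mem_expGroup _ (𝔤.smul_mem t ha))) x y

/-! ### The ideals of a reductive decomposition -/

section Decomposition

variable {𝔤 : LieSubalgebra ℝ (Matrix d d ℂ)}

theorem idealSpace_le (𝔞 : LieIdeal ℝ 𝔤) {x : Matrix d d ℂ} (hx : x ∈ idealSpace 𝔞) : x ∈ 𝔤 := by
  obtain ⟨x', -, rfl⟩ := hx
  exact x'.2

/-- The inclusion of an ideal of a Lie algebra of matrices into the space of all matrices. -/
def idealIncl (𝔞 : LieIdeal ℝ 𝔤) : 𝔞 →ₗ[ℝ] Matrix d d ℂ :=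
  𝔤.toSubmodule.subtype ∘ₗ 𝔞.toSubmodule.subtype

theorem idealIncl_mem (𝔞 : LieIdeal ℝ 𝔤) (x : 𝔞) : idealIncl 𝔞 x ∈ idealSpace 𝔞 :=
  Submodule.mem_map_of_mem x.2

theorem exists_idealIncl_eq {𝔞 : LieIdeal ℝ 𝔤} {x : Matrix d d ℂ} (hx : x ∈ idealSpace 𝔞) :
    ∃ x', idealIncl 𝔞 x' = x := by
  obtain ⟨x', hx', rfl⟩ := hx
  exact ⟨⟨x', hx'⟩, rfl⟩

theorem idealIncl_injective (𝔞 : LieIdeal ℝ 𝔤) : Function.Injective (idealIncl 𝔞) :=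
  fun _ _ h => Subtype.ext (Subtype.ext h)

theorem idealIncl_lie (𝔞 : LieIdeal ℝ 𝔤) (x y : 𝔞) :
    idealIncl 𝔞 ⁅x, y⁆ = ⁅idealIncl 𝔞 x, idealIncl 𝔞 y⁆ := rfl

theorem lie_mem_idealSpace {𝔞 : LieIdeal ℝ 𝔤} {a x : Matrix d d ℂ} (ha : a ∈ 𝔤)
    (hx : x ∈ idealSpace 𝔞) : ⁅a, x⁆ ∈ idealSpace 𝔞 := by
  obtain ⟨x, rfl⟩ := exists_idealIncl_eq hx
  exact idealIncl_mem 𝔞 ⁅(⟨a, ha⟩ : 𝔤), x⁆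

theorem eq_zero_of_map_lie_eq_zero_idealSpace {𝔞 : LieIdeal ℝ 𝔤} [LieAlgebra.IsSimple ℝ 𝔞]
    (f : Matrix d d ℂ →ₗ[ℝ] ℝ)
    (hf : ∀ x ∈ idealSpace 𝔞, ∀ y ∈ idealSpace 𝔞, f ⁅x, y⁆ = 0) {x : Matrix d d ℂ}
    (hx : x ∈ idealSpace 𝔞) : f x = 0 := by
  obtain ⟨x', rfl⟩ := exists_idealIncl_eq hx
  exact eq_zero_of_map_lie_eq_zero (f ∘ₗ idealIncl 𝔞)
    (fun a b => hf _ (idealIncl_mem 𝔞 a) _ (idealIncl_mem 𝔞 b)) x'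

/-- An invariant bilinear form vanishes between a simple ideal and anything that commutes with
it. -/
theorem eq_zero_of_invariant_of_commute {𝔞 : LieIdeal ℝ 𝔤} [LieAlgebra.IsSimple ℝ 𝔞]
    (β : Matrix d d ℂ →ₗ[ℝ] Matrix d d ℂ →ₗ[ℝ] ℝ)
    (hβ : ∀ a ∈ 𝔤, ∀ x y, β ⁅a, x⁆ y + β x ⁅a, y⁆ = 0) {x y : Matrix d d ℂ}
    (hx : x ∈ idealSpace 𝔞) (hy : ∀ a ∈ idealSpace 𝔞, ⁅a, y⁆ = 0) : β x y = 0 := by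
  refine eq_zero_of_map_lie_eq_zero_idealSpace (β.flip y) (fun a ha b _ => ?_) hx
  have := hβ a (idealSpace_le 𝔞 ha) b y
  rwa [hy a ha, map_zero, add_zero] at this

variable {m : ℕ} {𝔰 : Fin m → LieIdeal ℝ 𝔤} {𝔷 : LieIdeal ℝ 𝔤}

theorem IsReductiveDecomposition.lie_eq_zero (hdec : IsReductiveDecomposition 𝔰 𝔷)
    {i j : Option (Fin m)} (hij : i ≠ j) {x y : Matrix d d ℂ}
    (hx : x ∈ idealSpace (i.elim 𝔷 𝔰)) (hy : y ∈ idealSpace (j.elim 𝔷 𝔰)) : ⁅x, y⁆ = 0 := by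
  obtain ⟨x', rfl⟩ := exists_idealIncl_eq hx
  obtain ⟨y', rfl⟩ := exists_idealIncl_eq hy
  have hdis := hdec.isInternal.submodule_iSupIndep.pairwiseDisjoint hij
  have h : ⁅(x' : 𝔤), (y' : 𝔤)⁆ = 0 := Submodule.disjoint_def.mp hdis _
    (lie_mem_left ℝ 𝔤 (i.elim 𝔷 𝔰) x' y' x'.2) (lie_mem_right ℝ 𝔤 (j.elim 𝔷 𝔰) x' y' y'.2)
  exact congrArg Subtype.val h

theorem IsReductiveDecomposition.exists_sum (hdec : IsReductiveDecomposition 𝔰 𝔷)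
    {X : Matrix d d ℂ} (hX : X ∈ 𝔤) : ∃ Y : Option (Fin m) → Matrix d d ℂ,
      (∀ i, Y i ∈ idealSpace (i.elim 𝔷 𝔰)) ∧ X = ∑ i, Y i := by
  have h : (⟨X, hX⟩ : 𝔤) ∈ ⨆ i : Option (Fin m), (i.elim 𝔷 𝔰 : LieIdeal ℝ 𝔤).toSubmodule := by
    rw [hdec.isInternal.submodule_iSup_eq_top]
    trivial
  obtain ⟨f, hf, hsum⟩ := (Submodule.mem_iSup_iff_exists_finsupp _ _).mp h
  refine ⟨fun i => f i, fun i => Submodule.mem_map_of_mem (hf i), ?_⟩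
  rw [Finsupp.sum_fintype _ _ (fun _ => rfl)] at hsum
  have := congrArg (𝔤.toSubmodule.subtype) hsum
  rw [map_sum] at this
  exact this.symm

theorem IsReductiveDecomposition.lie_center (hdec : IsReductiveDecomposition 𝔰 𝔷)
    {z X : Matrix d d ℂ} (hz : z ∈ idealSpace 𝔷) (hX : X ∈ 𝔤) : ⁅X, z⁆ = 0 := by
  obtain ⟨Y, hY, rfl⟩ := hdec.exists_sum hX
  rw [sum_lie]
  refine Finset.sum_eq_zero fun i _ => ?_
  cases i with
  | none =>
    obtain ⟨z', rfl⟩ := exists_idealIncl_eq hz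
    obtain ⟨y', hy'⟩ := exists_idealIncl_eq (𝔞 := 𝔷) (hY none)
    have := hdec.abelian
    rw [← hy', ← idealIncl_lie, trivial_lie_zero, map_zero]
  | some j => exact hdec.lie_eq_zero (j := none) (by simp) (hY _) hz

/-- Different ideals of the decomposition are orthogonal for every invariant symmetric form. -/
theorem IsReductiveDecomposition.orthogonal (hdec : IsReductiveDecomposition 𝔰 𝔷)
    (β : Matrix d d ℂ →ₗ[ℝ] Matrix d d ℂ →ₗ[ℝ] ℝ) (hs : ∀ x y, β x y = β y x)
    (hβ : ∀ a ∈ 𝔤, ∀ x y, β ⁅a, x⁆ y + β x ⁅a, y⁆ = 0)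
    {i j : Option (Fin m)} (hij : i ≠ j) {x y : Matrix d d ℂ}
    (hx : x ∈ idealSpace (i.elim 𝔷 𝔰)) (hy : y ∈ idealSpace (j.elim 𝔷 𝔰)) : β x y = 0 := by
  have key {k l : Option (Fin m)} (hkl : k ≠ l) (hk : k.isSome) {x y : Matrix d d ℂ}
      (hx : x ∈ idealSpace (k.elim 𝔷 𝔰)) (hy : y ∈ idealSpace (l.elim 𝔷 𝔰)) : β x y = 0 := by
    obtain ⟨k, rfl⟩ := Option.isSome_iff_exists.mp hk
    have := hdec.simple k
    exact eq_zero_of_invariant_of_commute (𝔞 := 𝔰 k) β hβ hx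
      fun a ha => hdec.lie_eq_zero hkl (x := a) ha hy
  cases i with
  | some i => exact key hij rfl hx hy
  | none =>
    cases j with
    | none => exact absurd rfl hij
    | some j => rw [hs]; exact key hij.symm rfl hy hx

theorem exists_basis_idealSpace (hskew : ∀ X ∈ 𝔤, Xᴴ = -X) (𝔞 : LieIdeal ℝ 𝔤) :
    ∃ e : Fin (Module.finrank ℝ 𝔞) → Matrix d d ℂ, (∀ i, e i ∈ idealSpace 𝔞) ∧
      (∀ i j, hsForm (e i) (e j) = if i = j then 1 else 0) ∧
      (∀ x ∈ idealSpace 𝔞, x = ∑ i, hsForm (e i) x • e i) := by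
  obtain ⟨e, he⟩ := exists_orthonormal_basis (hsForm.compl₁₂ (idealIncl 𝔞) (idealIncl 𝔞))
    (fun x y => hsForm_comm _ _)
    (fun x hx => hsForm_pos (hskew _ (idealSpace_le 𝔞 (idealIncl_mem 𝔞 x)))
      ((map_ne_zero_iff _ (idealIncl_injective 𝔞)).mpr hx))
  refine ⟨fun i => idealIncl 𝔞 (e i), fun i => idealIncl_mem 𝔞 _, he, fun x hx => ?_⟩
  obtain ⟨x, rfl⟩ := exists_idealIncl_eq hx
  conv_lhs => rw [eq_sum_of_orthonormal _ e he x]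
  simp only [map_sum, map_smul, LinearMap.compl₁₂_apply]

/-- The Casimir tensor `∑ e i ⊗ e i` of an orthonormal basis of an ideal is invariant: the matrix of
`ad a` in an orthonormal basis is antisymmetric. -/
theorem sum_lie_orthonormal_eq_zero {𝔞 : LieIdeal ℝ 𝔤} {ι : Type*} [Fintype ι]
    {e : ι → Matrix d d ℂ} (hmem : ∀ i, e i ∈ idealSpace 𝔞)
    (hspan : ∀ x ∈ idealSpace 𝔞, x = ∑ i, hsForm (e i) x • e i) {a : Matrix d d ℂ} (ha : a ∈ 𝔤)
    (γ : Matrix d d ℂ →ₗ[ℝ] Matrix d d ℂ →ₗ[ℝ] ℝ) :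
    ∑ i, (γ ⁅a, e i⁆ (e i) + γ (e i) ⁅a, e i⁆) = 0 := by
  have h1 (i) : γ ⁅a, e i⁆ (e i) = ∑ k, hsForm (e k) ⁅a, e i⁆ * γ (e k) (e i) := by
    conv_lhs => rw [hspan _ (lie_mem_idealSpace ha (hmem i))]
    simp
  have h2 (i) : γ (e i) ⁅a, e i⁆ = ∑ k, hsForm (e k) ⁅a, e i⁆ * γ (e i) (e k) := by
    conv_lhs => rw [hspan _ (lie_mem_idealSpace ha (hmem i))]
    simp
  have h3 (i k) : hsForm (e k) ⁅a, e i⁆ = -hsForm (e i) ⁅a, e k⁆ := by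
    have := hsForm_lie a (e k) (e i)
    rw [hsForm_comm ⁅a, e k⁆] at this
    linarith
  rw [Finset.sum_add_distrib]
  simp only [h1, h2]
  rw [Finset.sum_comm, ← Finset.sum_add_distrib]
  refine Finset.sum_eq_zero fun k _ => ?_
  rw [← Finset.sum_add_distrib]
  refine Finset.sum_eq_zero fun i _ => ?_
  rw [h3 i k]
  ring

/-- The second moment on a simple ideal. By Schur's lemma it is a multiple `c` of the
Hilbert–Schmidt form; `c` is found by taking the trace of both forms. -/
theorem secondMomentForm_eq (hskew : ∀ X ∈ 𝔤, Xᴴ = -X) {𝔞 : LieIdeal ℝ 𝔤}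
    [LieAlgebra.IsSimple ℝ 𝔞] {B : Matrix d d ℂ} (hB : B.IsHermitian) {x : Matrix d d ℂ}
    (hx : x ∈ idealSpace 𝔞) :
    (secondMomentForm 𝔤 B x x : ℂ) =
      hsForm x x * purity (idealSpace 𝔞) B / (Module.finrank ℝ 𝔞 : ℂ) := by
  have hsk : ∀ x ∈ idealSpace 𝔞, xᴴ = -x := fun x hx => hskew x (idealSpace_le 𝔞 hx)
  obtain ⟨c, hc⟩ := exists_eq_mul_of_invariant (S := 𝔞)
    (hsForm.compl₁₂ (idealIncl 𝔞) (idealIncl 𝔞))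
    ((secondMomentForm 𝔤 B).compl₁₂ (idealIncl 𝔞) (idealIncl 𝔞))
    (fun x y => hsForm_comm _ _)
    (fun x hx => hsForm_pos (hsk _ (idealIncl_mem 𝔞 x))
      ((map_ne_zero_iff _ (idealIncl_injective 𝔞)).mpr hx))
    (fun a x y => hsForm_lie (idealIncl 𝔞 a) (idealIncl 𝔞 x) (idealIncl 𝔞 y))
    (fun x y => secondMomentForm_comm 𝔤 B _ _)
    (fun a x y => secondMomentForm_lie hskew B (idealSpace_le 𝔞 (idealIncl_mem 𝔞 a))
      (idealIncl 𝔞 x) (idealIncl 𝔞 y))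
  have hc' : ∀ x ∈ idealSpace 𝔞, secondMomentForm 𝔤 B x x = c * hsForm x x := by
    intro x hx
    obtain ⟨x, rfl⟩ := exists_idealIncl_eq hx
    exact hc x x
  obtain ⟨e, hmem, he, hspan⟩ := exists_basis_idealSpace hskew 𝔞
  -- Summed over an orthonormal basis, the integrand does not depend on the group element.
  have hsum : ∑ i, secondMomentForm 𝔤 B (e i) (e i) = ∑ i, imTrace B (e i) ^ 2 := by
    simp only [secondMomentForm_apply]
    rw [← integral_finsetSum _ fun i _ => integrable_imTrace_mul 𝔤 B (e i) (e i)]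
    have hV (V : expGroup 𝔤) : ∑ i, imTrace B (Ad (V : unitary (Matrix d d ℂ)) (e i)) *
        imTrace B (Ad (V : unitary (Matrix d d ℂ)) (e i)) = ∑ i, imTrace B (e i) ^ 2 := by
      have := sum_Ad_eq_of_infinitesimal hskew e
        (fun a ha γ => sum_lie_orthonormal_eq_zero hmem hspan ha γ) V.2
        ((LinearMap.mul ℝ ℝ).compl₁₂ (imTrace B) (imTrace B))
      simpa [pow_two] using this
    simp only [hV, integral_const, probReal_univ, one_smul]
  have hdim : c * (Module.finrank ℝ 𝔞 : ℝ) = ∑ i, imTrace B (e i) ^ 2 := by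
    rw [← hsum, Finset.sum_congr rfl fun i _ => hc' (e i) (hmem i)]
    simp [he, mul_comm]
  have hpos : (Module.finrank ℝ 𝔞 : ℂ) ≠ 0 := by
    have : Nontrivial 𝔞 := by
      by_contra h
      rw [not_nontrivial_iff_subsingleton] at h
      exact LieAlgebra.IsSimple.non_abelian (R := ℝ) (L := 𝔞)
        ⟨fun x y => Subsingleton.elim _ _⟩
    exact_mod_cast (Module.finrank_pos (R := ℝ) (M := 𝔞)).ne'
  rw [purity_eq_sum hsk hmem he hspan hB, ← hdim, hc' x hx]
  push_cast
  field_simp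

/-- The mean and the variance of `Re Tr[V (iX) V† B]` over the group generated by `𝔤`, for
`X ∈ 𝔤`. -/
theorem haar_mean_and_variance (hskew : ∀ X ∈ 𝔤, Xᴴ = -X)
    (hdec : IsReductiveDecomposition 𝔰 𝔷) {X B : Matrix d d ℂ} (hX : X ∈ 𝔤)
    (hB : B.IsHermitian) {f : expGroup 𝔤 → ℝ}
    (hf : ∀ V, f V = (Matrix.trace (Ad (V : unitary (Matrix d d ℂ)) (Complex.I • X) * B)).re) :
    ((∫ V, f V ∂haar 𝔤 : ℝ) : ℂ) = Matrix.trace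
        (proj (idealSpace 𝔷) (Complex.I • X) * proj (idealSpace 𝔷) B) ∧
      ((∫ V, f V ^ 2 ∂haar 𝔤 - (∫ V, f V ∂haar 𝔤) ^ 2 : ℝ) : ℂ) =
        ∑ j, purity (idealSpace (𝔰 j)) (Complex.I • X) * purity (idealSpace (𝔰 j)) B /
          (Module.finrank ℝ (𝔰 j) : ℂ) := by
  obtain ⟨Y, hY, hXY⟩ := hdec.exists_sum hX
  have hsk (𝔞 : LieIdeal ℝ 𝔤) : ∀ x ∈ idealSpace 𝔞, xᴴ = -x :=
    fun x hx => hskew x (idealSpace_le 𝔞 hx)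
  have hYskew (i) : (Y i)ᴴ = -Y i := hsk _ _ (hY i)
  have hf' (V) : f V = -imTrace B (Ad (V : unitary (Matrix d d ℂ)) X) := by
    rw [hf, imTrace_apply, Ad_apply, Ad_apply]
    simp
  have hproj (i : Option (Fin m)) :
      proj (idealSpace (i.elim 𝔷 𝔰)) (Complex.I • X) = Complex.I • Y i := by
    rw [hXY, ← Finset.add_sum_erase _ _ (Finset.mem_univ i)]
    refine proj_I_smul_add (hsk _) (hY i) ?_ fun v hv => ?_
    · rw [Matrix.conjTranspose_sum, ← Finset.sum_neg_distrib]
      exact Finset.sum_congr rfl fun k _ => hYskew k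
    · rw [map_sum]
      exact Finset.sum_eq_zero fun k hk => hdec.orthogonal hsForm hsForm_comm
        (fun a _ => hsForm_lie a) (Finset.ne_of_mem_erase hk).symm hv (hY k)
  have hfix (V : expGroup 𝔤) : Ad (V : unitary (Matrix d d ℂ)) (Y none) = Y none :=
    Ad_eq_self_of_lie_eq_zero hskew (fun X hX => hdec.lie_center (hY none) hX) V.2
  have hmean : ∫ V, f V ∂haar 𝔤 = -imTrace B (Y none) := by
    have h1 : meanForm 𝔤 B (Y none) = imTrace B (Y none) := by
      simp [meanForm_apply, hfix]
    have h2 (j : Fin m) : meanForm 𝔤 B (Y (some j)) = 0 := by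
      have := hdec.simple j
      exact eq_zero_of_map_lie_eq_zero_idealSpace (𝔞 := 𝔰 j) _
        (fun a ha b _ => meanForm_lie hskew B (idealSpace_le _ ha) b) (hY (some j))
    simp only [hf', integral_neg]
    rw [← meanForm_apply, hXY, map_sum, Fintype.sum_option, h1]
    simp [h2]
  have hsecond : ∫ V, f V ^ 2 ∂haar 𝔤 = imTrace B (Y none) ^ 2 +
      ∑ j, secondMomentForm 𝔤 B (Y (some j)) (Y (some j)) := by
    have h1 : secondMomentForm 𝔤 B (Y none) (Y none) = imTrace B (Y none) ^ 2 := by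
      simp [secondMomentForm_apply, hfix, pow_two]
    have h2 : ∫ V, f V ^ 2 ∂haar 𝔤 = secondMomentForm 𝔤 B X X := by
      simp only [hf', neg_mul_neg, pow_two, secondMomentForm_apply]
    have h3 : secondMomentForm 𝔤 B X X = ∑ i, secondMomentForm 𝔤 B (Y i) (Y i) := by
      rw [hXY, map_sum]
      refine Finset.sum_congr rfl fun i _ => ?_
      rw [map_sum, LinearMap.sum_apply]
      exact Finset.sum_eq_single i (fun k _ hk => hdec.orthogonal _ (secondMomentForm_comm 𝔤 B)
        (fun a ha => secondMomentForm_lie hskew B ha) hk (hY k) (hY i)) (by simp)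
    rw [h2, h3, Fintype.sum_option, h1]
  constructor
  · have h := hproj none
    simp only [Option.elim_none] at h
    rw [hmean, h, Matrix.smul_mul, Matrix.trace_smul, trace_mul_proj (hsk 𝔷) (hY none),
      trace_mul_eq_I_mul_imTrace (hYskew none) hB, smul_eq_mul, ← mul_assoc, Complex.I_mul_I]
    push_cast
    ring
  · rw [hmean, hsecond, neg_sq, add_sub_cancel_left, Complex.ofReal_sum]
    refine Finset.sum_congr rfl fun j _ => ?_
    have := hdec.simple j
    have h := hproj (some j)
    simp only [Option.elim_some] at h
    rw [secondMomentForm_eq (𝔞 := 𝔰 j) hskew hB (hY (some j))]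
    congr 2
    rw [purity, h, pow_two, Matrix.smul_mul, Matrix.mul_smul, smul_smul, Complex.I_mul_I, Matrix.trace_smul,
      trace_mul_eq_neg_hsForm (hYskew _) (hYskew _)]
    simp

end Decomposition

/-! ### From the design property to Haar averages -/

section Design

/-- The tensor product of two matrices, indexed by pairs encoded as functions on `Fin 2`. -/
def tensorPair (A B : Matrix d d ℂ) : Matrix (Fin 2 → d) (Fin 2 → d) ℂ :=
  Matrix.of fun a b => A (a 0) (b 0) * B (a 1) (b 1)

theorem tensorPow_two (A : Matrix d d ℂ) : tensorPow A 2 = tensorPair A A := by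
  ext a b
  simp [tensorPow, tensorPair, Fin.prod_univ_two]

theorem sum_pair (f g : d → ℂ) : ∑ c : Fin 2 → d, f (c 0) * g (c 1) = (∑ i, f i) * ∑ i, g i := by
  have := Finset.prod_univ_sum (fun _ : Fin 2 => (Finset.univ : Finset d))
    (fun k i => if k = 0 then f i else g i)
  simp only [Fin.prod_univ_two, if_true, Fintype.piFinset_univ, one_ne_zero, if_false] at this
  exact this.symm

theorem tensorPair_mul (A B C D : Matrix d d ℂ) :
    tensorPair A B * tensorPair C D = tensorPair (A * C) (B * D) := by
  ext a b
  simp only [tensorPair, Matrix.mul_apply, Matrix.of_apply]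
  rw [← sum_pair]
  exact Finset.sum_congr rfl fun c _ => by ring

theorem trace_tensorPair (A B : Matrix d d ℂ) :
    Matrix.trace (tensorPair A B) = Matrix.trace A * Matrix.trace B := by
  simp only [Matrix.trace, Matrix.diag, tensorPair, Matrix.of_apply]
  exact sum_pair (fun i => A i i) fun i => B i i

theorem trace_mul_eq_sum {ι : Type*} [Fintype ι] (A B : Matrix ι ι ℂ) :
    Matrix.trace (A * B) = ∑ a, ∑ b, A a b * B b a := by
  simp only [Matrix.trace, Matrix.diag, Matrix.mul_apply]

/-- A continuous function of a random unitary matrix is integrable. -/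
theorem integrable_of_unitary {Ω : Type*} [MeasurableSpace Ω] [TopologicalSpace Ω]
    [OpensMeasurableSpace Ω] {μ : Measure Ω} [IsFiniteMeasure μ] {U : Ω → Matrix d d ℂ}
    (hU : Continuous U) (hmem : ∀ ω, U ω ∈ unitary (Matrix d d ℂ)) {F : Matrix d d ℂ → ℂ}
    (hF : Continuous F) : Integrable (fun ω => F (U ω)) μ := by
  have hc : IsCompact (unitary (Matrix d d ℂ) : Set (Matrix d d ℂ)) :=
    isCompact_iff_compactSpace.mpr instCompactSpaceUnitary
  obtain ⟨C, hC⟩ := hc.exists_bound_of_continuousOn hF.continuousOn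
  exact Integrable.of_bound (hF.comp hU).aestronglyMeasurable C
    (Filter.Eventually.of_forall fun ω => hC _ (hmem ω))

/-- The trace of the second moment operator against a product observable. -/
theorem trace_moment_two {Ω : Type*} [MeasurableSpace Ω] [TopologicalSpace Ω]
    [OpensMeasurableSpace Ω] {μ : Measure Ω} [IsFiniteMeasure μ] {U : Ω → Matrix d d ℂ}
    (hU : Continuous U) (hmem : ∀ ω, U ω ∈ unitary (Matrix d d ℂ)) (A C D : Matrix d d ℂ) :
    Matrix.trace (moment μ U 2 (tensorPow A 2) * tensorPair C D) =
      ∫ ω, Matrix.trace (U ω * A * (U ω)ᴴ * C) * Matrix.trace (U ω * A * (U ω)ᴴ * D) ∂μ := by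
  have hint (a b : Fin 2 → d) : Integrable (fun ω =>
      (tensorPow (U ω) 2 * tensorPow A 2 * tensorPow (U ω)ᴴ 2) a b * tensorPair C D b a) μ := by
    refine integrable_of_unitary hU hmem (F := fun V =>
      (tensorPow V 2 * tensorPow A 2 * tensorPow Vᴴ 2) a b * tensorPair C D b a) ?_
    simp only [tensorPow_two, tensorPair_mul]
    simp only [tensorPair, Matrix.of_apply]
    fun_prop
  have hpt (ω) : Matrix.trace (U ω * A * (U ω)ᴴ * C) * Matrix.trace (U ω * A * (U ω)ᴴ * D) =
      ∑ a, ∑ b, (tensorPow (U ω) 2 * tensorPow A 2 * tensorPow (U ω)ᴴ 2) a b *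
        tensorPair C D b a := by
    rw [← trace_tensorPair, ← tensorPair_mul, ← tensorPair_mul, ← tensorPair_mul,
      ← trace_mul_eq_sum]
    simp only [tensorPow_two]
  simp only [hpt]
  rw [integral_finsetSum _ fun a _ => integrable_finsetSum _ fun b _ => hint a b]
  rw [trace_mul_eq_sum]
  refine Finset.sum_congr rfl fun a _ => ?_
  rw [integral_finsetSum _ fun b _ => hint a b]
  refine Finset.sum_congr rfl fun b _ => ?_
  rw [integral_mul_const]
  rfl

theorem continuous_circuit {L : ℕ} (H : Fin L → Matrix d d ℂ) : Continuous (circuit H) := by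
  unfold circuit
  simp only [List.ofFn_eq_map]
  refine continuous_list_prod _ fun l _ => continuous_matrix_exp.comp ?_
  fun_prop

theorem circuit_mem_unitary {L : ℕ} {H : Fin L → Matrix d d ℂ} (hH : ∀ l, (H l).IsHermitian)
    (θ : Fin L → ℝ) : circuit H θ ∈ unitary (Matrix d d ℂ) := by
  refine Submonoid.list_prod_mem _ fun U hU => ?_
  obtain ⟨l, rfl⟩ := (List.mem_ofFn' _ _).mp hU
  refine exp_mem_unitary ?_
  rw [Matrix.conjTranspose_smul, (hH l).eq, ← neg_smul]
  simp

theorem conjTranspose_eq_neg_of_mem_dla {L : ℕ} {H : Fin L → Matrix d d ℂ}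
    (hH : ∀ l, (H l).IsHermitian) : ∀ X ∈ dla H, Xᴴ = -X := by
  intro X hX
  induction hX using LieSubalgebra.lieSpan_induction with
  | mem x h =>
    obtain ⟨l, rfl⟩ := h
    simp [Matrix.conjTranspose_smul, (hH l).eq]
  | zero => simp
  | add x y _ _ hx hy => rw [Matrix.conjTranspose_add, hx, hy, neg_add]
  | smul a x _ hx => exact conjTranspose_real_smul hx a
  | lie x y _ _ hx hy =>
    simp [Ring.lie_def, Matrix.conjTranspose_sub, Matrix.conjTranspose_mul, hx, hy]

theorem ofReal_re_trace_conj {V ρ O : Matrix d d ℂ} (hρ : ρ.IsHermitian) (hO : O.IsHermitian) :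
    ((Matrix.trace (V * ρ * Vᴴ * O)).re : ℂ) = Matrix.trace (V * ρ * Vᴴ * O) := by
  apply Complex.conj_eq_iff_re.mp
  rw [starRingEnd_apply, ← Matrix.trace_conjTranspose]
  simp only [Matrix.conjTranspose_mul, Matrix.conjTranspose_conjTranspose, hρ.eq, hO.eq]
  rw [Matrix.trace_mul_comm]
  simp only [Matrix.mul_assoc]

/-- The loss of a group element. -/
def groupLoss (𝔤 : LieSubalgebra ℝ (Matrix d d ℂ)) (ρ O : Matrix d d ℂ) (V : expGroup 𝔤) : ℝ :=
  (Matrix.trace (Ad (V : unitary (Matrix d d ℂ)) ρ * O)).re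

theorem coe_groupLoss {𝔤 : LieSubalgebra ℝ (Matrix d d ℂ)} {ρ O : Matrix d d ℂ}
    (hρ : ρ.IsHermitian) (hO : O.IsHermitian) (V : expGroup 𝔤) :
    (groupLoss 𝔤 ρ O V : ℂ) = Matrix.trace (Ad (V : unitary (Matrix d d ℂ)) ρ * O) :=
  ofReal_re_trace_conj hρ hO

variable {L : ℕ} {H : Fin L → Matrix d d ℂ} {P : Measure (Fin L → ℝ)} [IsProbabilityMeasure P]

/-- Over a `2`-design, the average of a product of two traces is the Haar average. -/
theorem integral_trace_mul_trace_eq (hH : ∀ l, (H l).IsHermitian)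
    (hdesign : IsDesign P (circuit H) 2 (dla H)) (A C D : Matrix d d ℂ) :
    ∫ θ, Matrix.trace (circuit H θ * A * (circuit H θ)ᴴ * C) *
        Matrix.trace (circuit H θ * A * (circuit H θ)ᴴ * D) ∂P =
      ∫ V : expGroup (dla H), Matrix.trace (Ad (V : unitary (Matrix d d ℂ)) A * C) *
        Matrix.trace (Ad (V : unitary (Matrix d d ℂ)) A * D) ∂haar (dla H) := by
  rw [← trace_moment_two (continuous_circuit H) (circuit_mem_unitary hH), hdesign,
    trace_moment_two (by fun_prop) fun V => V.1.2]
  rfl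

theorem trace_circuit_conj (hH : ∀ l, (H l).IsHermitian) (A : Matrix d d ℂ) (θ : Fin L → ℝ) :
    Matrix.trace (circuit H θ * A * (circuit H θ)ᴴ) = Matrix.trace A := by
  have := (Unitary.mem_iff.mp (circuit_mem_unitary hH θ)).1
  rw [Matrix.star_eq_conjTranspose] at this
  rw [Matrix.trace_mul_comm, ← mul_assoc, this, one_mul]

theorem trace_Ad (V : unitary (Matrix d d ℂ)) (A : Matrix d d ℂ) :
    Matrix.trace (Ad V A) = Matrix.trace A := by
  have := (Unitary.mem_iff.mp V.2).1
  rw [Matrix.star_eq_conjTranspose] at this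
  rw [Ad_apply, Matrix.trace_mul_comm, ← mul_assoc, this, one_mul]

/-- A state has trace one, so the mean of the loss is a second moment with second observable the
identity. -/
theorem integral_loss_eq (hH : ∀ l, (H l).IsHermitian)
    (hdesign : IsDesign P (circuit H) 2 (dla H)) {ρ O : Matrix d d ℂ} (hρ : IsDensityMatrix ρ)
    (hO : O.IsHermitian) : ∫ θ, loss H ρ O θ ∂P = ∫ V, groupLoss (dla H) ρ O V ∂haar (dla H) := by
  have h := integral_trace_mul_trace_eq hH hdesign ρ O 1
  simp only [mul_one, trace_circuit_conj hH, trace_Ad, hρ.2, ← coe_loss H hρ.1.isHermitian hO,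
    ← coe_groupLoss hρ.1.isHermitian hO, integral_complex_ofReal] at h
  exact_mod_cast h

theorem integral_loss_sq_eq (hH : ∀ l, (H l).IsHermitian)
    (hdesign : IsDesign P (circuit H) 2 (dla H)) {ρ O : Matrix d d ℂ} (hρ : ρ.IsHermitian)
    (hO : O.IsHermitian) :
    ∫ θ, loss H ρ O θ ^ 2 ∂P = ∫ V, groupLoss (dla H) ρ O V ^ 2 ∂haar (dla H) := by
  have h := integral_trace_mul_trace_eq hH hdesign ρ O O
  simp only [← pow_two, ← coe_loss H hρ hO, ← coe_groupLoss hρ hO, ← Complex.ofReal_pow,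
    integral_complex_ofReal] at h
  exact_mod_cast h

theorem memLp_loss (hH : ∀ l, (H l).IsHermitian) (ρ O : Matrix d d ℂ) :
    MemLp (loss H ρ O) 2 P := by
  have hc : IsCompact (unitary (Matrix d d ℂ) : Set (Matrix d d ℂ)) :=
    isCompact_iff_compactSpace.mpr instCompactSpaceUnitary
  have hF : Continuous fun U : Matrix d d ℂ => (Matrix.trace (U * ρ * Uᴴ * O)).re := by
    have h : Continuous fun U : Matrix d d ℂ => U * ρ * Uᴴ * O :=
      ((continuous_id.matrix_mul continuous_const).matrix_mul
        continuous_id.matrix_conjTranspose).matrix_mul continuous_const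
    exact Complex.continuous_re.comp h.matrix_trace
  obtain ⟨C, hC⟩ := hc.exists_bound_of_continuousOn hF.continuousOn
  have hcont : Continuous (loss H ρ O) := hF.comp (continuous_circuit H)
  have hbound (θ) : ‖loss H ρ O θ‖ ≤ C := hC _ (circuit_mem_unitary hH θ)
  exact MemLp.of_bound hcont.aestronglyMeasurable C (Filter.Eventually.of_forall hbound)

/-- Exchanging the state and the observable inverts the group element. -/
theorem groupLoss_comm (𝔤 : LieSubalgebra ℝ (Matrix d d ℂ)) (ρ O : Matrix d d ℂ)
    (V : expGroup 𝔤) : groupLoss 𝔤 ρ O V = groupLoss 𝔤 O ρ V⁻¹ := by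
  have h : (((V⁻¹ : expGroup 𝔤) : unitary (Matrix d d ℂ)) : Matrix d d ℂ) =
      ((V : unitary (Matrix d d ℂ)) : Matrix d d ℂ)ᴴ := rfl
  rw [groupLoss, groupLoss, Ad_apply, Ad_apply, h, Matrix.conjTranspose_conjTranspose,
    mul_assoc (_ * ρ), Matrix.trace_mul_comm, ← mul_assoc]

end Design

end LieCircuit

end

theorem theorem1 (n L m : ℕ)
    (H : Fin L → Matrix (Fin (2 ^ n)) (Fin (2 ^ n)) ℂ) (hH : ∀ l, (H l).IsHermitian)
    (ρ O : Matrix (Fin (2 ^ n)) (Fin (2 ^ n)) ℂ)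
    (hρ : LieCircuit.IsDensityMatrix ρ) (hO : O.IsHermitian)
    (𝔰 : Fin m → LieIdeal ℝ (LieCircuit.dla H)) (𝔷 : LieIdeal ℝ (LieCircuit.dla H))
    (hdec : LieCircuit.IsReductiveDecomposition 𝔰 𝔷)
    (hmem : (∃ X ∈ LieCircuit.dla H, O = Complex.I • X) ∨
      (∃ X ∈ LieCircuit.dla H, ρ = Complex.I • X))
    (P : Measure (Fin L → ℝ)) [IsProbabilityMeasure P]
    (hdesign : LieCircuit.IsDesign P (LieCircuit.circuit H) 2 (LieCircuit.dla H)) :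
    ((∫ θ, LieCircuit.loss H ρ O θ ∂P : ℝ) : ℂ) =
        Matrix.trace (LieCircuit.proj (LieCircuit.idealSpace 𝔷) ρ *
          LieCircuit.proj (LieCircuit.idealSpace 𝔷) O) ∧
      ((variance (LieCircuit.loss H ρ O) P : ℝ) : ℂ) =
        ∑ j, LieCircuit.purity (LieCircuit.idealSpace (𝔰 j)) ρ *
            LieCircuit.purity (LieCircuit.idealSpace (𝔰 j)) O /
          (Module.finrank ℝ (𝔰 j) : ℂ) := by
  have hskew := LieCircuit.conjTranspose_eq_neg_of_mem_dla hH
  rw [variance_eq_sub (LieCircuit.memLp_loss hH ρ O)]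
  simp only [Pi.pow_apply]
  rw [LieCircuit.integral_loss_sq_eq hH hdesign hρ.1.isHermitian hO,
    LieCircuit.integral_loss_eq hH hdesign hρ hO]
  rcases hmem with ⟨X, hX, rfl⟩ | ⟨X, hX, rfl⟩
  · -- Inverting the group element moves its action from the state to the observable.
    have hinv (k : ℕ) : ∫ V, LieCircuit.groupLoss (LieCircuit.dla H) ρ (Complex.I • X) V ^ k
          ∂LieCircuit.haar (LieCircuit.dla H) =
        ∫ V, LieCircuit.groupLoss (LieCircuit.dla H) (Complex.I • X) ρ V ^ k
          ∂LieCircuit.haar (LieCircuit.dla H) := by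
      simp only [LieCircuit.groupLoss_comm _ ρ]
      exact integral_inv_eq_self
        (fun V => LieCircuit.groupLoss (LieCircuit.dla H) (Complex.I • X) ρ V ^ k) _
    have h1 := hinv 1
    simp only [pow_one] at h1
    rw [h1, hinv 2]
    obtain ⟨hm, hv⟩ := LieCircuit.haar_mean_and_variance hskew hdec hX hρ.1.isHermitian
      (f := LieCircuit.groupLoss (LieCircuit.dla H) (Complex.I • X) ρ) fun _ => rfl
    refine ⟨hm.trans (Matrix.trace_mul_comm _ _), hv.trans ?_⟩
    exact Finset.sum_congr rfl fun j _ => by rw [mul_comm]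
  · exact LieCircuit.haar_mean_and_variance hskew hdec hX hO fun _ => rfl
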